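/- Let $G$ be a finite group and $p\in[0,1]$. For $S\subseteq G$ the undirected Cayley graph $\Gamma(G;S)$ has vertex set $G$, and distinct $g,h\in G$ are adjacent if and only if $g^{-1}h\in S$ or $h^{-1}g\in S$. Let $\mathcal G(G,p)$ be the probability space of the graphs $\Gamma(G;S)$ in which every element of $G$ is put into $S$ independently with probability $p$. The diameter of a disconnected graph is $\infty$. Fix real numbers $\gamma\in(0,1)$ and $\varepsilon\in(0,1]$, and put $$d_N=(1-\gamma)\sqrt{\frac{\log N}{2\log\log N}}.$$ Let $d,N\in\mathbb N$ with $2\le d\le d_N$, and let $G$ be any group of order $N$. If $\Gamma\in\mathcal G(G,p)$, where $$0\le p\le\sqrt[d]{\frac{1-\varepsilon}{2^d}\cdot\frac{\log N}{N^{d-1}}},$$ then with high probability the diameter of $\Gamma$ is greater than $d$. Here "with high probability" means that the error probability tends to $0$ as $N\to\infty$, uniformly: for every $\eta>0$ there is an $N_0=N_0(\gamma,\varepsilon,\eta)$ such that for all $N\ge N_0$, all groups $G$ of order $N$, and all $d$ and $p$ as above, the diameter of $\Gamma$ is greater than $d$ with probability at least $1-\eta$. -/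

import Mathlib

namespace RandomCayley

open MeasureTheory ProbabilityTheory

/-- The model `𝒢(G, p)`: every element of `G` is put into a random set `S` independently with
probability `p`, and the random graph is the undirected Cayley graph `Γ(G; S)`, in which distinct
`g` and `h` are adjacent iff `g⁻¹ * h ∈ S` or `h⁻¹ * g ∈ S`. -/
noncomputable def randomCayleyGraph (G : Type*) [Group G] (p : unitInterval) :
    Measure (SimpleGraph G) :=
  (setBernoulli (Set.univ : Set G) p).map fun S => SimpleGraph.mulCayley S

/-- The pushforward in `randomCayleyGraph` is along a measurable map. -/
theorem measurable_mulCayley (G : Type*) [Group G] :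
    Measurable fun S : Set G => SimpleGraph.mulCayley S := by
  refine measurable_comap_iff.2 ?_
  refine measurable_pi_iff.2 fun u => measurable_pi_iff.2 fun v => ?_
  have h : (fun S : Set G => (SimpleGraph.Adj ∘ fun S : Set G => SimpleGraph.mulCayley S) S u v) =
      fun S : Set G => u ≠ v ∧ (u⁻¹ * v ∈ S ∨ v⁻¹ * u ∈ S) := by
    funext S
    exact propext (SimpleGraph.mulCayley_adj S u v)
  have h2 : Measurable fun S : Set G => u ≠ v ∧ (u⁻¹ * v ∈ S ∨ v⁻¹ * u ∈ S) := by
    have hm : ∀ g : G, Measurable fun S : Set G => g ∈ S := fun g => measurable_set_mem g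
    exact measurable_const.and ((hm _).or (hm _))
  rw [h]
  exact h2

instance (G : Type*) [Group G] (p : unitInterval) :
    IsProbabilityMeasure (randomCayleyGraph G p) :=
  Measure.isProbabilityMeasure_map (measurable_mulCayley G).aemeasurable

/-- `d_N = (1 - γ) √(log N / (2 log log N))`. -/
noncomputable def diamBound (γ : ℝ) (N : ℕ) : ℝ :=
  (1 - γ) * Real.sqrt (Real.log N / (2 * Real.log (Real.log N)))

end RandomCayley

/-! By vertex transitivity it suffices to find some `g` that is not a word of length at most `d` in
the elements of `S` and their inverses. The number of such `g` is shown to be positive by the second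
moment method.

A word reaching `g` uses either `d` distinct letters (a full support) or fewer (a small support).
With `N = |G|` and `L = log N`, there are at most `2 ^ d * N ^ (d - 1)` full supports of `g`, so the
expected number inside `S` is at most `(1 - ε) L`. Harris' inequality then gives `g` probability at
least `N ^ (-(1 - ε / 2))` of avoiding all of them. Small supports have negligible total weight on
average over `g`, so for at least half of the elements they cost only a factor `1 - δ`. The mean
number of unreached elements is therefore at least `N ^ (ε / 2) / 4`.

For the variance, a Janson-type bound (`bernoulliProb_avoid_union_le`) shows that two elements are
almost independently unreached, unless they share many full supports. A set of at most `d` elements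
generates at most `(3d) ^ d` group elements in `d` steps, so each `g` has few such partners.
Cauchy–Schwarz finishes the argument.

The errors are controlled by comparing `Y = (N L) ^ (1 / d)`, which bounds `2 p N`, with `(3d) ^ d`
times a power of `L`. The restriction on `d` gives `2 d ^ 2 log L ≤ L`, which makes `Y` win. -/

namespace RandomCayley

open Finset

/-! ### Set families and avoidance events. -/

section Avoid

variable {α : Type*}

/-- The event that the random set contains no member of `F`. -/
def avoid (F : Finset (Finset α)) : Set (Finset α) := {S | ∀ A ∈ F, ¬ A ⊆ S}

lemma isLowerSet_avoid (F : Finset (Finset α)) : IsLowerSet (avoid F) :=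
  fun _ _ h hS A hA hAT => hS A hA (hAT.trans h)

lemma isUpperSet_superset (A : Finset α) : IsUpperSet {S : Finset α | A ⊆ S} :=
  fun _ _ h hS => subset_trans hS h

variable [DecidableEq α]

lemma avoid_union (F H : Finset (Finset α)) : avoid (F ∪ H) = avoid F ∩ avoid H := by
  ext S
  simp only [avoid, mem_union, Set.mem_ofPred_eq, Set.mem_inter_iff]
  grind

lemma avoid_insert (A : Finset α) (F : Finset (Finset α)) :
    avoid (insert A F) = {S | A ⊆ S}ᶜ ∩ avoid F := by
  ext S; simp [avoid]

end Avoid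

/-! ### Random subsets: Harris, Janson and the second moment. -/

section Bernoulli

variable {α : Type*} [Fintype α] [DecidableEq α]

/-- The probability that the `p`-random subset of `α` equals `S`. -/
noncomputable def bernoulliWeight (p : ℝ) (S : Finset α) : ℝ :=
  ∏ x, if x ∈ S then p else 1 - p

/-- The probability that the `p`-random subset of `α` belongs to `E`. -/
noncomputable def bernoulliProb (p : ℝ) (E : Set (Finset α)) : ℝ :=
  ∑ S, bernoulliWeight p S * E.indicator 1 S

lemma bernoulliWeight_eq (p : ℝ) (S : Finset α) :
    bernoulliWeight p S = p ^ #S * (1 - p) ^ #Sᶜ := by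
  rw [bernoulliWeight, prod_ite, prod_const, prod_const, filter_mem_eq_inter, univ_inter]
  congr 2
  congr 1
  ext; simp

lemma bernoulliWeight_nonneg {p : ℝ} (h0 : 0 ≤ p) (h1 : p ≤ 1) (S : Finset α) :
    0 ≤ bernoulliWeight p S :=
  prod_nonneg fun x _ => by split_ifs <;> linarith

lemma sum_bernoulliWeight (p : ℝ) : ∑ S : Finset α, bernoulliWeight p S = 1 := by
  simp only [bernoulliWeight_eq, card_compl]
  rw [Fintype.sum_pow_mul_eq_add_pow]
  simp

lemma bernoulliProb_univ (p : ℝ) : bernoulliProb p (Set.univ : Set (Finset α)) = 1 := by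
  simp [bernoulliProb, sum_bernoulliWeight]

lemma bernoulliProb_nonneg {p : ℝ} (h0 : 0 ≤ p) (h1 : p ≤ 1) (E : Set (Finset α)) :
    0 ≤ bernoulliProb p E :=
  sum_nonneg fun S _ => mul_nonneg (bernoulliWeight_nonneg h0 h1 S)
    (Set.indicator_nonneg (fun _ _ => zero_le_one) S)

lemma bernoulliProb_mono {p : ℝ} (h0 : 0 ≤ p) (h1 : p ≤ 1) {E E' : Set (Finset α)}
    (h : E ⊆ E') : bernoulliProb p E ≤ bernoulliProb p E' :=
  sum_le_sum fun S _ => mul_le_mul_of_nonneg_left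
    (Set.indicator_le_indicator_of_subset h (fun _ => zero_le_one) S)
    (bernoulliWeight_nonneg h0 h1 S)

lemma bernoulliProb_inter_add_inter_compl (p : ℝ) (E E' : Set (Finset α)) :
    bernoulliProb p (E ∩ E') + bernoulliProb p (E ∩ E'ᶜ) = bernoulliProb p E := by
  simp only [bernoulliProb, ← sum_add_distrib, ← mul_add]
  refine sum_congr rfl fun S _ => ?_
  congr 1
  by_cases h : S ∈ E <;> by_cases h' : S ∈ E' <;> simp [Set.indicator, h, h']

lemma bernoulliProb_compl (p : ℝ) (E : Set (Finset α)) :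
    bernoulliProb p Eᶜ = 1 - bernoulliProb p E := by
  have := bernoulliProb_inter_add_inter_compl p Set.univ E
  rw [bernoulliProb_univ, Set.univ_inter, Set.univ_inter] at this
  linarith

lemma bernoulliProb_le_add_sum {p : ℝ} (h0 : 0 ≤ p) (h1 : p ≤ 1) {ι : Type*}
    {E E' : Set (Finset α)} (s : Finset ι) (T : ι → Set (Finset α))
    (h : ∀ S ∈ E, S ∉ E' → ∃ i ∈ s, S ∈ T i) :
    bernoulliProb p E ≤ bernoulliProb p E' + ∑ i ∈ s, bernoulliProb p (T i) := by
  simp only [bernoulliProb]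
  rw [sum_comm, ← sum_add_distrib]
  refine sum_le_sum fun S _ => ?_
  rw [← mul_sum, ← mul_add]
  refine mul_le_mul_of_nonneg_left ?_ (bernoulliWeight_nonneg h0 h1 S)
  have hT : ∀ i ∈ s, (0 : ℝ) ≤ (T i).indicator 1 S := fun i _ =>
    Set.indicator_nonneg (fun _ _ => zero_le_one) S
  have hE' : (0 : ℝ) ≤ E'.indicator 1 S := Set.indicator_nonneg (fun _ _ => zero_le_one) S
  by_cases hE : S ∈ E
  · by_cases hS : S ∈ E'
    · have := sum_nonneg hT
      simp only [Set.indicator_of_mem hE, Set.indicator_of_mem hS, Pi.one_apply]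
      linarith
    · obtain ⟨i, hi, hSi⟩ := h S hE hS
      have := single_le_sum hT hi
      rw [Set.indicator_of_mem hSi] at this
      rw [Set.indicator_of_mem hE]
      linarith
  · rw [Set.indicator_of_notMem hE]
    have := sum_nonneg hT
    linarith

/-- Harris' inequality for increasing events. -/
lemma bernoulliProb_mul_le_inter_of_isUpperSet {p : ℝ} (h0 : 0 ≤ p) (h1 : p ≤ 1)
    {E E' : Set (Finset α)} (hE : IsUpperSet E) (hE' : IsUpperSet E') :
    bernoulliProb p E * bernoulliProb p E' ≤ bernoulliProb p (E ∩ E') := by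
  have mono : ∀ {D : Set (Finset α)}, IsUpperSet D → Monotone (D.indicator (1 : Finset α → ℝ)) := by
    intro D hD S T hST
    by_cases h : S ∈ D
    · rw [Set.indicator_of_mem h, Set.indicator_of_mem (hD hST h)]; rfl
    · rw [Set.indicator_of_notMem h]
      exact Set.indicator_nonneg (fun _ _ => zero_le_one) T
  have key := fkg (α := Finset α) (μ := bernoulliWeight p) (f := E.indicator 1)
    (g := E'.indicator 1) (fun S => bernoulliWeight_nonneg h0 h1 S)
    (fun S => Set.indicator_nonneg (fun _ _ => zero_le_one) S)
    (fun S => Set.indicator_nonneg (fun _ _ => zero_le_one) S) (mono hE) (mono hE') ?_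
  · rw [sum_bernoulliWeight, one_mul] at key
    refine key.trans (le_of_eq ?_)
    refine sum_congr rfl fun S _ => ?_
    rw [Set.inter_indicator_one]; rfl
  · intro S T
    refine le_of_eq ?_
    simp only [bernoulliWeight, ← prod_mul_distrib]
    refine prod_congr rfl fun x _ => ?_
    by_cases hS : x ∈ S <;> by_cases hT : x ∈ T <;> simp [hS, hT, mul_comm]

/-- Harris' inequality for an increasing and a decreasing event. -/
lemma bernoulliProb_inter_le_mul {p : ℝ} (h0 : 0 ≤ p) (h1 : p ≤ 1)
    {E E' : Set (Finset α)} (hE : IsUpperSet E) (hE' : IsLowerSet E') :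
    bernoulliProb p (E ∩ E') ≤ bernoulliProb p E * bernoulliProb p E' := by
  have h := bernoulliProb_mul_le_inter_of_isUpperSet h0 h1 hE hE'.compl
  rw [bernoulliProb_compl] at h
  linarith [bernoulliProb_inter_add_inter_compl p E E']

/-- Harris' inequality for decreasing events. -/
lemma bernoulliProb_mul_le_inter_of_isLowerSet {p : ℝ} (h0 : 0 ≤ p) (h1 : p ≤ 1)
    {E E' : Set (Finset α)} (hE : IsLowerSet E) (hE' : IsLowerSet E') :
    bernoulliProb p E * bernoulliProb p E' ≤ bernoulliProb p (E ∩ E') := by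
  have h := bernoulliProb_inter_le_mul h0 h1 hE.compl hE'
  rw [bernoulliProb_compl] at h
  have := bernoulliProb_inter_add_inter_compl p E' E
  rw [Set.inter_comm, Set.inter_comm E'] at this
  linarith

lemma bernoulliProb_mem_inter (p : ℝ) (x : α) {E : Set (Finset α)}
    (hE : ∀ S, x ∉ S → (insert x S ∈ E ↔ S ∈ E)) :
    bernoulliProb p ({S | x ∈ S} ∩ E) = p * bernoulliProb p E := by
  have hu : (univ : Finset (Finset α)) = (insert x (univ.erase x)).powerset := by
    rw [insert_erase (mem_univ x), powerset_univ]
  have hx : x ∉ (univ : Finset α).erase x := notMem_erase _ _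
  simp only [bernoulliProb]
  rw [hu, sum_powerset_insert hx, sum_powerset_insert hx, ← sum_add_distrib, ← sum_add_distrib,
    mul_sum]
  refine sum_congr rfl fun S hS => ?_
  have hxS : x ∉ S := fun h => hx (mem_powerset.1 hS h)
  have e1 : bernoulliWeight p S = (1 - p) * ∏ y ∈ univ.erase x, if y ∈ S then p else 1 - p := by
    rw [bernoulliWeight, ← mul_prod_erase univ _ (mem_univ x), if_neg hxS]
  have e2 : bernoulliWeight p (insert x S) =
      p * ∏ y ∈ univ.erase x, if y ∈ S then p else 1 - p := by
    rw [bernoulliWeight, ← mul_prod_erase univ _ (mem_univ x), if_pos (mem_insert_self x S)]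
    congr 1
    refine prod_congr rfl fun y hy => ?_
    simp [ne_of_mem_erase hy]
  rw [e1, e2]
  by_cases h : S ∈ E
  · have h' := (hE S hxS).2 h
    simp [Set.indicator, h, h', hxS]
    left; ring
  · have h' := mt (hE S hxS).1 h
    simp [Set.indicator, h, h', hxS]

/-- Independence: `hE` says that membership in `E` does not depend on the coordinates in `A`. -/
lemma bernoulliProb_subset_inter (p : ℝ) (A : Finset α) {E : Set (Finset α)}
    (hE : ∀ x ∈ A, ∀ S, x ∉ S → (insert x S ∈ E ↔ S ∈ E)) :
    bernoulliProb p ({S | A ⊆ S} ∩ E) = p ^ #A * bernoulliProb p E := by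
  induction A using Finset.induction_on with
  | empty => simp
  | insert a A ha ih =>
    have h1 : {S | insert a A ⊆ S} ∩ E = {S | a ∈ S} ∩ ({S | A ⊆ S} ∩ E) := by
      ext S; simp [insert_subset_iff, and_assoc]
    rw [h1, bernoulliProb_mem_inter, ih fun x hx => hE x (mem_insert_of_mem hx),
      card_insert_of_notMem ha]
    · ring
    · intro S hS
      simp only [Set.mem_inter_iff, Set.mem_ofPred_eq, hE a (mem_insert_self a A) S hS,
        subset_insert_iff_of_notMem ha]

lemma bernoulliProb_subset (p : ℝ) (A : Finset α) :
    bernoulliProb p {S | A ⊆ S} = p ^ #A := by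
  have := bernoulliProb_subset_inter p A (E := Set.univ) (by simp)
  rwa [Set.inter_univ, bernoulliProb_univ, mul_one] at this

lemma prod_le_bernoulliProb_avoid {p : ℝ} (h0 : 0 ≤ p) (h1 : p ≤ 1) (F : Finset (Finset α)) :
    ∏ A ∈ F, (1 - p ^ #A) ≤ bernoulliProb p (avoid F) := by
  induction F using Finset.induction_on with
  | empty => simp [avoid, bernoulliProb_univ]
  | insert A F hA ih =>
    rw [prod_insert hA, avoid_insert, ← bernoulliProb_subset p A, ← bernoulliProb_compl]
    exact (mul_le_mul_of_nonneg_left ih (bernoulliProb_nonneg h0 h1 _)).trans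
      (bernoulliProb_mul_le_inter_of_isLowerSet h0 h1 (isUpperSet_superset A).compl
        (isLowerSet_avoid F))

lemma one_sub_sum_le_bernoulliProb_avoid {p : ℝ} (h0 : 0 ≤ p) (h1 : p ≤ 1)
    (F : Finset (Finset α)) :
    1 - ∑ A ∈ F, p ^ #A ≤ bernoulliProb p (avoid F) := by
  have := bernoulliProb_le_add_sum h0 h1 (E := Set.univ) (E' := avoid F) F
    (fun A => {S | A ⊆ S}) (fun S _ hS => by simpa [avoid] using hS)
  simp only [bernoulliProb_univ, bernoulliProb_subset] at this
  linarith

/-- The conditional estimate behind Janson's inequality. -/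
lemma mul_bernoulliProb_avoid_le {p : ℝ} (h0 : 0 ≤ p) (h1 : p ≤ 1) (A : Finset α)
    (F : Finset (Finset α)) :
    (p ^ #A - ∑ B ∈ F with ¬ Disjoint A B, p ^ #(A ∪ B)) * bernoulliProb p (avoid F) ≤
      bernoulliProb p ({S | A ⊆ S} ∩ avoid F) := by
  -- Only the members of `F` disjoint from `A` are kept, which makes `D₀` independent of `A ⊆ S`.
  -- The remaining members are handled by a union bound, each term estimated by Harris.
  set D₀ := avoid {B ∈ F | Disjoint A B} with hD₀
  have hsub : avoid F ⊆ D₀ := fun S hS B hB => hS B (mem_filter.1 hB).1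
  have hind : bernoulliProb p ({S | A ⊆ S} ∩ D₀) = p ^ #A * bernoulliProb p D₀ := by
    refine bernoulliProb_subset_inter p A fun x hx S _ => forall₂_congr fun B hB => ?_
    rw [subset_insert_iff_of_notMem]
    exact fun hxB => disjoint_left.1 (mem_filter.1 hB).2 hx hxB
  have hle := bernoulliProb_le_add_sum h0 h1 (E := {S | A ⊆ S} ∩ D₀)
    (E' := {S | A ⊆ S} ∩ avoid F) {B ∈ F | ¬ Disjoint A B}
    (fun B => {S | A ∪ B ⊆ S} ∩ D₀) (by
      rintro S ⟨hA, hS⟩ hn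
      have hn' : S ∉ avoid F := fun h => hn ⟨hA, h⟩
      simp only [avoid, Set.mem_ofPred_eq, not_forall, not_not] at hn'
      obtain ⟨B, hB, hBS⟩ := hn'
      refine ⟨B, mem_filter.2 ⟨hB, fun hd => hS B (mem_filter.2 ⟨hB, hd⟩) hBS⟩,
        union_subset hA hBS, hS⟩)
  have hsum : ∑ B ∈ F with ¬ Disjoint A B, bernoulliProb p ({S | A ∪ B ⊆ S} ∩ D₀) ≤
      (∑ B ∈ F with ¬ Disjoint A B, p ^ #(A ∪ B)) * bernoulliProb p D₀ := by
    rw [sum_mul]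
    refine sum_le_sum fun B _ => ?_
    rw [← bernoulliProb_subset]
    exact bernoulliProb_inter_le_mul h0 h1 (isUpperSet_superset _) (isLowerSet_avoid _)
  rcases le_total (p ^ #A - ∑ B ∈ F with ¬ Disjoint A B, p ^ #(A ∪ B)) 0 with hneg | hpos
  · exact (mul_nonpos_of_nonpos_of_nonneg hneg (bernoulliProb_nonneg h0 h1 _)).trans
      (bernoulliProb_nonneg h0 h1 _)
  · refine (mul_le_mul_of_nonneg_left (bernoulliProb_mono h0 h1 hsub) hpos).trans ?_
    rw [sub_mul]
    linarith

/-- A form of Janson's inequality for uniform families, relative to avoiding a family `H`. -/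
lemma bernoulliProb_avoid_union_le {p : ℝ} (h0 : 0 ≤ p) (h1 : p ≤ 1) {d : ℕ}
    (hp : p ^ d ≤ 1 / 2) (F H : Finset (Finset α)) (hF : ∀ A ∈ F, #A = d) :
    bernoulliProb p (avoid (F ∪ H)) ≤ bernoulliProb p (avoid H) * (1 - p ^ d) ^ #F *
      Real.exp (2 * ∑ A ∈ F, (∑ B ∈ F.erase A with ¬ Disjoint A B, p ^ #(A ∪ B) +
        ∑ B ∈ H with ¬ Disjoint A B, p ^ #(A ∪ B))) := by
  -- The overlap sums stay over all of `F`, so the error term of each `A` is fixed during the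
  -- induction on `F'`.
  suffices h : ∀ F' ⊆ F, bernoulliProb p (avoid (F' ∪ H)) ≤
      bernoulliProb p (avoid H) * (1 - p ^ d) ^ #F' *
      Real.exp (2 * ∑ A ∈ F', (∑ B ∈ F.erase A with ¬ Disjoint A B, p ^ #(A ∪ B) +
        ∑ B ∈ H with ¬ Disjoint A B, p ^ #(A ∪ B))) from h F Subset.rfl
  intro F'
  induction F' using Finset.induction_on with
  | empty => simp
  | insert A F' hA ih =>
    intro hsub
    obtain ⟨hAF, hF'⟩ := insert_subset_iff.1 hsub
    specialize ih hF'
    set c := ∑ B ∈ F.erase A with ¬ Disjoint A B, p ^ #(A ∪ B) +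
        ∑ B ∈ H with ¬ Disjoint A B, p ^ #(A ∪ B) with hc
    have hnn : ∀ B : Finset α, 0 ≤ p ^ #(A ∪ B) := fun B => pow_nonneg h0 _
    have hc0 : 0 ≤ c := add_nonneg (sum_nonneg fun B _ => hnn B) (sum_nonneg fun B _ => hnn B)
    have hδ : ∑ B ∈ F' ∪ H with ¬ Disjoint A B, p ^ #(A ∪ B) ≤ c := by
      rw [filter_union]
      refine (sum_union_inter (s₁ := {B ∈ F' | ¬ Disjoint A B})
        (s₂ := {B ∈ H | ¬ Disjoint A B}) (f := fun B => p ^ #(A ∪ B))).le.trans' ?_ |>.trans ?_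
      · exact le_add_of_nonneg_right (sum_nonneg fun B _ => hnn B)
      · refine add_le_add (sum_le_sum_of_subset_of_nonneg ?_ fun B _ _ => hnn B) le_rfl
        refine filter_subset_filter _ fun B hB => mem_erase.2 ⟨?_, hF' hB⟩
        rintro rfl
        exact hA hB
    have key := mul_bernoulliProb_avoid_le h0 h1 A (F' ∪ H)
    rw [hF A hAF] at key
    have hsplit := bernoulliProb_inter_add_inter_compl p (avoid (F' ∪ H)) {S | A ⊆ S}
    rw [Set.inter_comm, Set.inter_comm (avoid (F' ∪ H))] at hsplit
    rw [insert_union, avoid_insert, sum_insert hA, card_insert_of_notMem hA, ← hc]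
    set P := bernoulliProb p (avoid (F' ∪ H))
    have hP : 0 ≤ P := bernoulliProb_nonneg h0 h1 _
    have hq : 0 ≤ p ^ d := pow_nonneg h0 d
    have hstep : bernoulliProb p ({S | A ⊆ S}ᶜ ∩ avoid (F' ∪ H)) ≤ (1 - p ^ d + c) * P := by
      have := mul_le_mul_of_nonneg_right hδ hP
      linarith
    -- Since `1 - p ^ d ≥ 1 / 2`, the term `2 * c * (1 - p ^ d)` already covers `c`; this is the
    -- source of the factor 2 in the exponent.
    have hexp : 1 - p ^ d + c ≤ (1 - p ^ d) * Real.exp (2 * c) := by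
      have h2 := Real.add_one_le_exp (2 * c)
      have := mul_le_mul_of_nonneg_left h2 (by linarith : 0 ≤ 1 - p ^ d)
      have h3 : 0 ≤ c * (1 / 2 - p ^ d) := mul_nonneg hc0 (by linarith)
      linarith
    refine hstep.trans ((mul_le_mul hexp ih hP
      (mul_nonneg (by linarith) (Real.exp_nonneg _))).trans (le_of_eq ?_))
    rw [mul_add 2 c, Real.exp_add, pow_succ]
    ring

/-- The second moment method. -/
lemma sq_sum_bernoulliProb_le {p : ℝ} (h0 : 0 ≤ p) (h1 : p ≤ 1) {ι : Type*} (C : Finset ι)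
    (E : ι → Set (Finset α)) :
    (∑ g ∈ C, bernoulliProb p (E g)) ^ 2 ≤
      bernoulliProb p (⋃ g ∈ C, E g) * ∑ g ∈ C, ∑ h ∈ C, bernoulliProb p (E g ∩ E h) := by
  set U := ⋃ g ∈ C, E g with hU
  set X : Finset α → ℝ := fun S => ∑ g ∈ C, (E g).indicator 1 S with hX
  have hw := fun S : Finset α => bernoulliWeight_nonneg h0 h1 S
  have e1 : ∑ g ∈ C, bernoulliProb p (E g) = ∑ S, bernoulliWeight p S * X S := by
    simp only [bernoulliProb, hX, mul_sum]
    exact sum_comm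
  have e2 : ∑ g ∈ C, ∑ h ∈ C, bernoulliProb p (E g ∩ E h) =
      ∑ S, bernoulliWeight p S * X S ^ 2 := by
    have hsq : ∀ S, X S ^ 2 = ∑ g ∈ C, ∑ h ∈ C, (E g).indicator 1 S * (E h).indicator 1 S :=
      fun S => by simp only [hX, sq, sum_mul_sum]
    simp only [bernoulliProb, hsq, mul_sum, Set.inter_indicator_one, Pi.mul_apply]
    rw [sum_congr rfl fun g _ => sum_comm, sum_comm]
  have hXU : ∀ S, X S = X S * U.indicator 1 S := by
    intro S
    by_cases h : S ∈ U
    · rw [Set.indicator_of_mem h, Pi.one_apply, mul_one]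
    · have : X S = 0 := sum_eq_zero fun g hg =>
        Set.indicator_of_notMem (fun hS => h (Set.mem_biUnion hg hS)) _
      rw [this, zero_mul]
  -- Cauchy–Schwarz for `X = X * 1_U`, with the weight split into two square roots.
  have hcs := sum_mul_sq_le_sq_mul_sq univ
    (fun S : Finset α => √(bernoulliWeight p S) * U.indicator 1 S)
    (fun S => √(bernoulliWeight p S) * X S)
  have t1 : ∀ S : Finset α, √(bernoulliWeight p S) * U.indicator 1 S *
      (√(bernoulliWeight p S) * X S) = bernoulliWeight p S * X S := by
    intro S
    rw [mul_mul_mul_comm, Real.mul_self_sqrt (hw S), mul_comm _ (X S), ← hXU]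
  have t2 : ∀ S : Finset α, (√(bernoulliWeight p S) * U.indicator 1 S) ^ 2 =
      bernoulliWeight p S * U.indicator 1 S := by
    intro S
    rw [mul_pow, Real.sq_sqrt (hw S)]
    by_cases h : S ∈ U <;> simp [h]
  have t3 : ∀ S : Finset α, (√(bernoulliWeight p S) * X S) ^ 2 = bernoulliWeight p S * X S ^ 2 := by
    intro S
    rw [mul_pow, Real.sq_sqrt (hw S)]
  simp only [t1, t2, t3] at hcs
  rw [e1, e2]
  exact hcs

open ProbabilityTheory MeasureTheory in
/-- `bernoulliProb` computes the measure `setBernoulli` on a finite type. -/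
lemma bernoulliProb_eq_setBernoulli (p : unitInterval) (E : Set (Set α)) :
    bernoulliProb p {S : Finset α | (S : Set α) ∈ E} =
      (setBernoulli (Set.univ : Set α) p).real E := by
  classical
  have hE : E = ⋃ S ∈ ({S : Finset α | (S : Set α) ∈ E} : Finset (Finset α)), {(S : Set α)} := by
    ext T
    simp only [mem_filter, mem_univ, true_and, Set.mem_iUnion, Set.mem_singleton_iff, exists_prop]
    refine ⟨fun h => ⟨T.toFinset, by simpa using h, by simp⟩, ?_⟩
    rintro ⟨S, hS, rfl⟩
    exact hS
  conv_rhs => rw [hE]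
  rw [measureReal_biUnion_finset (fun S _ T _ h => by simpa using h)
    (fun S _ => (Set.toFinite _).measurableSet), bernoulliProb, sum_filter]
  refine sum_congr rfl fun S _ => ?_
  rw [setBernoulli_real_singleton p (Set.subset_univ _) Set.finite_univ, bernoulliWeight_eq,
    ← Set.compl_eq_univ_sdiff, ← coe_compl, Set.ncard_coe_finset, Set.ncard_coe_finset]
  by_cases h : (S : Set α) ∈ E <;> simp [h]

end Bernoulli

end RandomCayley

namespace RandomCayley

open Finset
open scoped Pointwise

/-! ### Signed words and the supports that generate an element. -/

section Words

variable {G : Type*} [Group G]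

/-- The value `∏ i, s i ^ (± 1)` of the word with letters `s` and signs `e`. -/
def signedProd {d : ℕ} (s : Fin d → G) (e : Fin d → Bool) : G :=
  (List.ofFn fun i => if e i then s i else (s i)⁻¹).prod

lemma signedProd_succ {d : ℕ} (s : Fin (d + 1) → G) (e : Fin (d + 1) → Bool) :
    signedProd s e = (if e 0 then s 0 else (s 0)⁻¹) *
      signedProd (fun i => s i.succ) (fun i => e i.succ) := by
  simp [signedProd, List.ofFn_succ]

/-- By cancellation, the value of a word and all letters but one determine the missing letter. This
saves a factor `N` in every count of words with prescribed value. -/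
lemma signedProd_injective_coordinate {d : ℕ} {s s' : Fin d → G} {e : Fin d → Bool} (i₀ : Fin d)
    (h : ∀ i, i ≠ i₀ → s i = s' i) (hp : signedProd s e = signedProd s' e) : s = s' := by
  induction d with
  | zero => exact i₀.elim0
  | succ d ih =>
    rw [signedProd_succ, signedProd_succ] at hp
    have aux : s 0 = s' 0 → (fun i : Fin d => s i.succ) = (fun i => s' i.succ) → s = s' := by
      intro h0 hs
      funext i
      refine Fin.cases h0 (fun j => congrFun hs j) i
    by_cases h0 : i₀ = 0
    · subst h0
      have hs : (fun i : Fin d => s i.succ) = fun i => s' i.succ :=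
        funext fun i => h _ (Fin.succ_ne_zero i)
      rw [hs, mul_left_inj] at hp
      refine aux ?_ hs
      split_ifs at hp
      · exact hp
      · exact inv_injective hp
    · obtain ⟨j, rfl⟩ := Fin.exists_succ_eq.2 h0
      have h00 := h 0 (Ne.symm h0)
      rw [h00, mul_right_inj] at hp
      exact aux h00 (ih j (fun i hi => h _ (fun h => hi (Fin.succ_injective _ h))) hp)

lemma exists_signedProd_of_walk {S : Set G} {u v : G} (w : (SimpleGraph.mulCayley S).Walk u v) :
    ∃ (s : Fin w.length → G) (e : Fin w.length → Bool), (∀ i, s i ∈ S) ∧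
      u * signedProd s e = v := by
  induction w with
  | nil => exact ⟨Fin.elim0, Fin.elim0, fun i => i.elim0, by simp [signedProd]⟩
  | @cons u v z h w ih =>
    obtain ⟨s, e, hs, hse⟩ := ih
    rw [SimpleGraph.mulCayley_adj] at h
    have key : ∀ (x : G) (b : Bool), x ∈ S → u * (if b then x else x⁻¹) = v →
        ∃ (s : Fin (w.length + 1) → G) (e : Fin (w.length + 1) → Bool), (∀ i, s i ∈ S) ∧
          u * signedProd s e = z := by
      intro x b hx hb
      refine ⟨Fin.cons x s, Fin.cons b e, Fin.cases hx hs, ?_⟩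
      rw [signedProd_succ, ← mul_assoc]
      simp only [Fin.cons_zero, Fin.cons_succ]
      rw [hb, hse]
    rcases h.2 with h | h
    · exact key _ true h (by simp)
    · exact key _ false h (by simp)

variable [DecidableEq G]

lemma signedProd_mem_pow {d : ℕ} (s : Fin d → G) (e : Fin d → Bool) (B : Finset G)
    -- Including `1` lets shorter words be padded to length `d`.
    (hs : ∀ i, s i ∈ B) : signedProd s e ∈ (insert 1 (B ∪ B⁻¹)) ^ d := by
  rw [Finset.mem_pow]
  refine ⟨fun i => ⟨if e i then s i else (s i)⁻¹, ?_⟩, rfl⟩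
  split_ifs <;> simp [hs i]

lemma card_insert_one_union_inv_pow_le (B : Finset G) {d : ℕ} (hd : 1 ≤ d) (hB : #B ≤ d) :
    #((insert 1 (B ∪ B⁻¹)) ^ d) ≤ (3 * d) ^ d := by
  refine card_pow_le.trans (Nat.pow_le_pow_left ?_ d)
  have h1 := card_insert_le 1 (B ∪ B⁻¹)
  have h2 := card_union_le B B⁻¹
  rw [card_inv] at h2
  omega

variable [Fintype G]

/-- The `d`-element supports of the signed words of length `d` with value `g`. -/
def fullSupports (d : ℕ) (g : G) : Finset (Finset G) :=
  {A | #A = d ∧ ∃ (s : Fin d → G) (e : Fin d → Bool), univ.image s = A ∧ signedProd s e = g}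

/-- The sets of less than `d` elements that generate `g` within `d` steps. -/
def smallSupports (d : ℕ) (g : G) : Finset (Finset G) :=
  {B | #B < d ∧ g ∈ (insert 1 (B ∪ B⁻¹)) ^ d}

/-- The event that a random set contains no set generating `g` within `d` steps. -/
def unreached (d : ℕ) (g : G) : Set (Finset G) := avoid (fullSupports d g ∪ smallSupports d g)

lemma mem_fullSupports {d : ℕ} {g : G} {A : Finset G} :
    A ∈ fullSupports d g ↔ #A = d ∧
      ∃ (s : Fin d → G) (e : Fin d → Bool), univ.image s = A ∧ signedProd s e = g := by
  simp [fullSupports]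

lemma mem_smallSupports {d : ℕ} {g : G} {B : Finset G} :
    B ∈ smallSupports d g ↔ #B < d ∧ g ∈ (insert 1 (B ∪ B⁻¹)) ^ d := by
  simp [smallSupports]

lemma mem_pow_of_mem_fullSupports {d : ℕ} {g : G} {A : Finset G} (h : A ∈ fullSupports d g) :
    g ∈ (insert 1 (A ∪ A⁻¹)) ^ d := by
  obtain ⟨-, s, e, rfl, rfl⟩ := mem_fullSupports.1 h
  exact signedProd_mem_pow s e _ fun i => mem_image_of_mem s (mem_univ i)

/-- A walk from `1` to `g` of length `k ≤ d` spells a word whose letters form a subset of `S`. If it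
has fewer than `d` distinct letters, they form a small support; otherwise `k = d` and they form a
full one. -/
lemma lt_ediam_of_mem_unreached {d : ℕ} {g : G} {S : Finset G} (h : S ∈ unreached d g) :
    (d : ℕ∞) < (SimpleGraph.mulCayley (S : Set G)).ediam := by
  by_contra hle
  have hg : (SimpleGraph.mulCayley (S : Set G)).edist 1 g ≤ d :=
    SimpleGraph.edist_le_ediam.trans (not_lt.1 hle)
  obtain ⟨w, hw⟩ := SimpleGraph.exists_walk_of_edist_ne_top
    (ne_top_of_le_ne_top (ENat.natCast_ne_top d) hg)
  obtain ⟨s, e, hs, hse⟩ := exists_signedProd_of_walk w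
  rw [one_mul] at hse
  have hwd : w.length ≤ d := by
    rw [← hw] at hg
    exact_mod_cast hg
  generalize w.length = k at *
  set B := univ.image s with hB
  have hBS : B ⊆ S := fun x hx => by
    obtain ⟨i, -, rfl⟩ := mem_image.1 hx
    exact hs i
  have hcard : #B ≤ k := card_image_le.trans (by simp)
  rcases lt_or_ge #B d with hlt | hge
  · refine h B (mem_union_right _ (mem_smallSupports.2 ⟨hlt, ?_⟩)) hBS
    refine pow_subset_pow_right (mem_insert_self _ _) hwd ?_
    rw [← hse]
    exact signedProd_mem_pow s e _ fun i => mem_image_of_mem s (mem_univ i)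
  · obtain rfl : k = d := by omega
    exact h B (mem_union_left _ (mem_fullSupports.2 ⟨by omega, s, e, rfl, hse⟩)) hBS

/-- One position outside `R` is determined by the others and by `g`; each position in `R` has `#A`
choices and the other free ones have `|G|`. -/
lemma card_filter_signedProd_le {d : ℕ} (e : Fin d → Bool) (g : G) (A : Finset G)
    (R : Finset (Fin d)) (hR : #R < d) :
    #{s : Fin d → G | (∀ i ∈ R, s i ∈ A) ∧ signedProd s e = g} ≤
      #A ^ #R * Fintype.card G ^ (d - 1 - #R) := by
  obtain ⟨i₀, hi₀⟩ : ∃ i, i ∉ R := by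
    by_contra! h
    have : R = univ := eq_univ_iff_forall.2 h
    simp [this] at hR
  let T : Finset ({i : Fin d // i ≠ i₀} → G) :=
    Fintype.piFinset fun i => if (i : Fin d) ∈ R then A else univ
  have hT : #T = #A ^ #R * Fintype.card G ^ (d - 1 - #R) := by
    have hsub : ∀ f : Fin d → ℕ, ∏ i : {i : Fin d // i ≠ i₀}, f i = ∏ i ∈ univ.erase i₀, f i :=
      fun f => (prod_subtype (univ.erase i₀) (by simp) f).symm
    have hRe : {i ∈ univ.erase i₀ | i ∈ R} = R := by
      ext i
      simp only [mem_filter, mem_erase, mem_univ, and_true]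
      exact ⟨fun h => h.2, fun h => ⟨fun h' => hi₀ (h' ▸ h), h⟩⟩
    have hcard := card_filter_add_card_filter_not (s := univ.erase i₀) (fun i => i ∈ R)
    rw [hRe, card_erase_of_mem (mem_univ _), card_univ, Fintype.card_fin] at hcard
    rw [Fintype.card_piFinset]
    simp only [apply_ite card, card_univ]
    rw [hsub (fun i => if i ∈ R then #A else Fintype.card G), prod_ite, prod_const, prod_const,
      hRe]
    congr 2
    omega
  rw [← hT]
  refine card_le_card_of_injOn (fun s i => s i) ?_ ?_
  · intro s hs
    simp only [coe_filter, mem_univ, true_and, Set.mem_ofPred_eq] at hs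
    rw [mem_coe, Fintype.mem_piFinset]
    intro i
    split_ifs with h
    · exact hs.1 i h
    · exact mem_univ _
  · intro s hs s' hs' h
    simp only [coe_filter, mem_univ, true_and, Set.mem_ofPred_eq] at hs hs'
    exact signedProd_injective_coordinate i₀ (fun i hi => congrFun h ⟨i, hi⟩)
      (hs.2.trans hs'.2.symm)

/-- The factors count the signs, the `r` positions whose letters lie in `A` (at most `d ^ r`
choices), and the words with these data. -/
lemma card_filter_fullSupports_le {d r : ℕ} (hr : r < d) (g : G) (A : Finset G) :
    #{B ∈ fullSupports d g | #(A ∩ B) = r} ≤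
      2 ^ d * (d ^ r * (#A ^ r * Fintype.card G ^ (d - 1 - r))) := by
  have hsub : {B ∈ fullSupports d g | #(A ∩ B) = r} ⊆
      (univ : Finset (Fin d → Bool)).biUnion fun e =>
        (powersetCard r (univ : Finset (Fin d))).biUnion fun R =>
          ({s : Fin d → G | (∀ i ∈ R, s i ∈ A) ∧ signedProd s e = g} : Finset (Fin d → G)).image
            fun s => univ.image s := by
    intro B hB
    obtain ⟨hB, hr⟩ := mem_filter.1 hB
    obtain ⟨hd, s, e, rfl, hse⟩ := mem_fullSupports.1 hB
    have hinj : Function.Injective s := by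
      rw [← Set.injOn_univ, ← coe_univ]
      exact card_image_iff.1 (by rw [hd]; simp)
    simp only [mem_biUnion, mem_univ, true_and, mem_image, mem_filter, mem_powersetCard,
      subset_univ]
    refine ⟨e, ({i | s i ∈ A} : Finset (Fin d)), ?_, s, ⟨by simp, hse⟩, rfl⟩
    rw [← hr, ← card_image_of_injective _ hinj]
    congr 1
    ext x
    simp only [mem_image, mem_filter, mem_univ, true_and, mem_inter]
    constructor
    · rintro ⟨i, hi, rfl⟩
      exact ⟨hi, i, rfl⟩
    · rintro ⟨hx, i, rfl⟩
      exact ⟨i, hx, rfl⟩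
  refine (card_le_card hsub).trans ?_
  refine (card_biUnion_le_card_mul _ _ (d ^ r * (#A ^ r * Fintype.card G ^ (d - 1 - r)))
    fun e _ => ?_).trans (by simp)
  refine (card_biUnion_le_card_mul _ _ (#A ^ r * Fintype.card G ^ (d - 1 - r))
    fun R hR => ?_).trans ?_
  · have hR' := (mem_powersetCard.1 hR).2
    refine card_image_le.trans ?_
    have := card_filter_signedProd_le e g A R (by omega)
    rwa [hR'] at this
  · refine Nat.mul_le_mul_right _ ?_
    rw [card_powersetCard, card_univ, Fintype.card_fin]
    exact Nat.choose_le_pow d r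

lemma card_fullSupports_le {d : ℕ} (hd : 1 ≤ d) (g : G) :
    #(fullSupports d g) ≤ 2 ^ d * Fintype.card G ^ (d - 1) := by
  simpa using card_filter_fullSupports_le (r := 0) (by omega) g (∅ : Finset G)

/-- A double count: a set of at most `d` elements supports few group elements. -/
lemma card_filter_mem_supports_le {d : ℕ} (hd : 1 ≤ d) (B : Finset G) :
    #{g : G | B ∈ smallSupports d g} ≤ (3 * d) ^ d ∧
      #{g : G | B ∈ fullSupports d g} ≤ (3 * d) ^ d := by
  constructor
  · by_cases hB : #B < d
    · refine (card_le_card fun g hg => ?_).trans (card_insert_one_union_inv_pow_le B hd hB.le)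
      exact (mem_smallSupports.1 (mem_filter.1 hg).2).2
    · rw [filter_false_of_mem fun g _ h => hB (mem_smallSupports.1 h).1]
      simp
  · by_cases hB : #B = d
    · refine (card_le_card fun g hg => ?_).trans (card_insert_one_union_inv_pow_le B hd hB.le)
      exact mem_pow_of_mem_fullSupports (mem_filter.1 hg).2
    · rw [filter_false_of_mem fun g _ h => hB (mem_fullSupports.1 h).1]
      simp

end Words

end RandomCayley

namespace RandomCayley

open Finset

/-! ### Overlaps, small supports and pair correlations. -/

section Estimates

variable {G : Type*} [Group G] [Fintype G] [DecidableEq G]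

/-- The `B` with `#(A ∩ B) = r` contribute at most `p ^ d * (2 d² / Y) ^ r * L`. As `2 d² ≤ Y`, each
of the fewer than `d` values of `r` is bounded by the case `r = 1`. -/
lemma sum_pow_card_union_le {d : ℕ} {p Y L : ℝ} (hd : 1 ≤ d) (hp : 0 ≤ p) (hL : 0 ≤ L)
    (hYd : Y ^ d = Fintype.card G * L) (hy : 2 * p * Fintype.card G ≤ Y)
    (hY : 2 * (d : ℝ) ^ 2 ≤ Y) (g : G) {A : Finset G} (hA : #A = d) :
    ∑ B ∈ fullSupports d g with B ≠ A ∧ ¬ Disjoint A B, p ^ #(A ∪ B) ≤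
      p ^ d * (2 * (d : ℝ) ^ 3 * L / Y) := by
  set N := (Fintype.card G : ℝ) with hN
  have hNpos : 0 < N := by rw [hN]; exact_mod_cast Fintype.card_pos
  have hd' : (1 : ℝ) ≤ d := by exact_mod_cast hd
  have hYpos : 0 < Y := by nlinarith
  have hterm : ∀ r ∈ Icc 1 (d - 1), ∑ B ∈ fullSupports d g with #(A ∩ B) = r, p ^ #(A ∪ B) ≤
      p ^ d * (2 * (d : ℝ) ^ 2 * L / Y) := by
    intro r hr
    obtain ⟨hr1, hrd⟩ := mem_Icc.1 hr
    have hcard : (#{B ∈ fullSupports d g | #(A ∩ B) = r} : ℝ) ≤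
        2 ^ d * (d ^ r * (d ^ r * N ^ (d - 1 - r))) := by
      have := card_filter_fullSupports_le (by omega : r < d) g A
      rw [hA] at this
      rw [hN]
      exact_mod_cast this
    have hsum : ∑ B ∈ fullSupports d g with #(A ∩ B) = r, p ^ #(A ∪ B) =
        #{B ∈ fullSupports d g | #(A ∩ B) = r} * p ^ (2 * d - r) := by
      rw [← nsmul_eq_mul, ← sum_const]
      refine sum_congr rfl fun B hB => ?_
      obtain ⟨hB, hr⟩ := mem_filter.1 hB
      have h1 := (mem_fullSupports.1 hB).1
      have h2 := card_union_add_card_inter A B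
      congr 1
      omega
    rw [hsum]
    refine (mul_le_mul_of_nonneg_right hcard (pow_nonneg hp _)).trans ?_
    obtain ⟨k, rfl⟩ : ∃ k, d = r + k + 1 := ⟨d - r - 1, by omega⟩
    have e1 : r + k + 1 - 1 - r = k := by omega
    have e2 : 2 * (r + k + 1) - r = (r + k + 1) + (k + 1) := by omega
    rw [e1, e2, pow_add p]
    set D : ℝ := ((r + k + 1 : ℕ) : ℝ)
    have e3 : 2 ^ (r + k + 1) * (D ^ r * (D ^ r * N ^ k)) * (p ^ (r + k + 1) * p ^ (k + 1)) =
        p ^ (r + k + 1) * ((2 * D ^ 2) ^ r * (2 * p * N) ^ (k + 1) / N) := by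
      field_simp
      ring
    rw [e3]
    refine mul_le_mul_of_nonneg_left ?_ (pow_nonneg hp _)
    have hypow : (2 * p * N) ^ (k + 1) ≤ Y ^ (k + 1) := pow_le_pow_left₀ (by positivity) hy _
    have hbase : (2 * D ^ 2 / Y) ^ r ≤ 2 * D ^ 2 / Y :=
      pow_le_of_le_one (by positivity) ((div_le_one hYpos).2 hY) (by omega)
    calc (2 * D ^ 2) ^ r * (2 * p * N) ^ (k + 1) / N
        ≤ (2 * D ^ 2) ^ r * Y ^ (k + 1) / N := by gcongr
      _ = (2 * D ^ 2 / Y) ^ r * (Y ^ (r + k + 1) / N) := by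
          rw [div_pow, add_assoc, pow_add Y]
          field_simp
          ring
      _ = (2 * D ^ 2 / Y) ^ r * L := by
          rw [hYd]
          field_simp
      _ ≤ 2 * D ^ 2 / Y * L := mul_le_mul_of_nonneg_right hbase hL
      _ = 2 * D ^ 2 * L / Y := by ring
  have hmaps : ∀ B ∈ {B ∈ fullSupports d g | B ≠ A ∧ ¬ Disjoint A B},
      #(A ∩ B) ∈ Icc 1 (d - 1) := by
    intro B hB
    obtain ⟨hB, hBA, hdis⟩ := mem_filter.1 hB
    have h1 := (mem_fullSupports.1 hB).1
    have h2 : 0 < #(A ∩ B) := card_pos.2 (not_disjoint_iff_nonempty_inter.1 hdis)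
    have h3 : #(A ∩ B) < d := by
      rw [← hA]
      refine card_lt_card ⟨inter_subset_left, fun h => hBA ?_⟩
      exact (eq_of_subset_of_card_le (h.trans inter_subset_right) (by omega)).symm
    exact mem_Icc.2 ⟨h2, by omega⟩
  rw [← sum_fiberwise_of_maps_to hmaps]
  calc ∑ r ∈ Icc 1 (d - 1), ∑ B ∈ {B ∈ fullSupports d g | B ≠ A ∧ ¬ Disjoint A B} with
          #(A ∩ B) = r, p ^ #(A ∪ B)
      ≤ ∑ r ∈ Icc 1 (d - 1), p ^ d * (2 * (d : ℝ) ^ 2 * L / Y) := by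
        refine sum_le_sum fun r hr => (sum_le_sum_of_subset_of_nonneg ?_ ?_).trans (hterm r hr)
        · exact filter_subset_filter _ (filter_subset _ _)
        · exact fun B _ _ => pow_nonneg hp _
    _ ≤ d * (p ^ d * (2 * (d : ℝ) ^ 2 * L / Y)) := by
        rw [sum_const, nsmul_eq_mul, Nat.card_Icc]
        refine mul_le_mul_of_nonneg_right ?_ (by positivity)
        exact_mod_cast (by omega : d - 1 + 1 - 1 ≤ d)
    _ = p ^ d * (2 * (d : ℝ) ^ 3 * L / Y) := by ring

/-- Each `B` serves at most `(3d) ^ d` elements, and the sets of size `k < d` weigh at most `(p N) ^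
k ≤ Y ^ (d - 1) = N L / Y`. -/
lemma sum_smallSupports_le {d : ℕ} {p Y L : ℝ} (hd : 1 ≤ d) (hp : 0 ≤ p)
    (hYd : Y ^ d = Fintype.card G * L) (hy : p * Fintype.card G ≤ Y) (hY : 1 ≤ Y) :
    ∑ g : G, ∑ B ∈ smallSupports d g, p ^ #B ≤
      (3 * d : ℝ) ^ d * (d * (Fintype.card G * L / Y)) := by
  have hswap : ∑ g : G, ∑ B ∈ smallSupports d g, p ^ #B =
      ∑ B : Finset G with #B < d, #{g : G | B ∈ smallSupports d g} * p ^ #B := by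
    rw [sum_comm' (t' := ({B : Finset G | #B < d} : Finset (Finset G)))
      (s' := fun B => ({g : G | B ∈ smallSupports d g} : Finset G))]
    · simp only [sum_const, nsmul_eq_mul]
    · intro g B
      simp only [mem_univ, true_and, mem_filter]
      exact ⟨fun h => ⟨h, (mem_smallSupports.1 h).1⟩, fun h => h.1⟩
  rw [hswap]
  have hY0 : 0 < Y := by linarith
  have hpow : Y ^ (d - 1) = Fintype.card G * L / Y := by
    rw [← hYd, eq_div_iff hY0.ne', ← pow_succ, Nat.sub_add_cancel hd]
  have h1 : ∑ B : Finset G with #B < d, p ^ #B ≤ d * Y ^ (d - 1) := by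
    have hmaps : ∀ B ∈ ({B : Finset G | #B < d} : Finset (Finset G)), #B ∈ range d :=
      fun B hB => mem_range.2 (mem_filter.1 hB).2
    rw [← sum_fiberwise_of_maps_to hmaps]
    calc _ ≤ ∑ k ∈ range d, Y ^ (d - 1) := by
          refine sum_le_sum fun k hk => ?_
          have hk' := mem_range.1 hk
          have hset : {B ∈ ({B : Finset G | #B < d} : Finset (Finset G)) | #B = k} =
              powersetCard k univ := by
            ext B
            simp only [mem_filter, mem_univ, true_and, mem_powersetCard, subset_univ]
            omega
          rw [hset, sum_congr rfl fun B hB => by rw [(mem_powersetCard.1 hB).2], sum_const,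
            card_powersetCard, card_univ, nsmul_eq_mul]
          calc ((Fintype.card G).choose k : ℝ) * p ^ k ≤ (Fintype.card G : ℝ) ^ k * p ^ k := by
                refine mul_le_mul_of_nonneg_right ?_ (pow_nonneg hp k)
                exact_mod_cast Nat.choose_le_pow _ k
            _ = (p * Fintype.card G) ^ k := by rw [← mul_pow, mul_comm]
            _ ≤ Y ^ k := pow_le_pow_left₀ (by positivity) hy k
            _ ≤ Y ^ (d - 1) := pow_le_pow_right₀ hY (by omega)
      _ = d * Y ^ (d - 1) := by simp
  calc ∑ B : Finset G with #B < d, (#{g : G | B ∈ smallSupports d g} : ℝ) * p ^ #B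
      ≤ ∑ B : Finset G with #B < d, (3 * d : ℝ) ^ d * p ^ #B := by
        refine sum_le_sum fun B _ => mul_le_mul_of_nonneg_right ?_ (pow_nonneg hp _)
        exact_mod_cast (card_filter_mem_supports_le hd B).1
    _ ≤ _ := by
        rw [← mul_sum, ← hpow]
        exact mul_le_mul_of_nonneg_left h1 (by positivity)

/-- Markov's inequality in `h`: each full support of `g` is shared with at most `(3d) ^ d` elements
`h`. -/
lemma card_filter_lt_card_inter_le {d : ℕ} {p L δ : ℝ} (hd : 1 ≤ d) (hp : 0 ≤ p) (hδ : 0 < δ)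
    (g : G) (hF : #(fullSupports d g) * p ^ d ≤ L) :
    (#{h : G | δ < #(fullSupports d g ∩ fullSupports d h) * p ^ d} : ℝ) ≤
      L * (3 * d : ℝ) ^ d / δ := by
  rw [le_div_iff₀ hδ]
  have hswap : ∑ h : G, #(fullSupports d g ∩ fullSupports d h) =
      ∑ A ∈ fullSupports d g, #{h : G | A ∈ fullSupports d h} := by
    simp only [← filter_mem_eq_inter, card_filter]
    exact sum_comm
  have hcount : ∑ h : G, #(fullSupports d g ∩ fullSupports d h) ≤
      #(fullSupports d g) * (3 * d) ^ d := by
    rw [hswap, ← smul_eq_mul]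
    exact sum_le_card_nsmul _ _ _ fun A _ => (card_filter_mem_supports_le hd A).2
  have hcount' : ∑ h : G, (#(fullSupports d g ∩ fullSupports d h) : ℝ) ≤
      #(fullSupports d g) * (3 * d : ℝ) ^ d := by exact_mod_cast hcount
  calc (#{h : G | δ < #(fullSupports d g ∩ fullSupports d h) * p ^ d} : ℝ) * δ
      ≤ ∑ h : G with δ < #(fullSupports d g ∩ fullSupports d h) * p ^ d,
          #(fullSupports d g ∩ fullSupports d h) * p ^ d := by
        rw [← nsmul_eq_mul]
        exact card_nsmul_le_sum _ _ _ fun h hh => (mem_filter.1 hh).2.le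
    _ ≤ ∑ h : G, #(fullSupports d g ∩ fullSupports d h) * p ^ d :=
        sum_le_sum_of_subset_of_nonneg (filter_subset _ _) fun h _ _ => by positivity
    _ = (∑ h : G, (#(fullSupports d g ∩ fullSupports d h) : ℝ)) * p ^ d := by rw [sum_mul]
    _ ≤ #(fullSupports d g) * (3 * d : ℝ) ^ d * p ^ d :=
        mul_le_mul_of_nonneg_right hcount' (by positivity)
    _ = #(fullSupports d g) * p ^ d * (3 * d : ℝ) ^ d := by ring
    _ ≤ L * (3 * d : ℝ) ^ d := mul_le_mul_of_nonneg_right hF (by positivity)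

lemma mul_one_sub_le_bernoulliProb_unreached {d : ℕ} {p δ : ℝ} (h0 : 0 ≤ p) (h1 : p ≤ 1) {g : G}
    (hg : ∑ B ∈ smallSupports d g, p ^ #B ≤ δ) :
    bernoulliProb p (avoid (fullSupports d g)) * (1 - δ) ≤ bernoulliProb p (unreached d g) := by
  rw [unreached, avoid_union]
  refine le_trans (mul_le_mul_of_nonneg_left ?_ (bernoulliProb_nonneg h0 h1 _))
    (bernoulliProb_mul_le_inter_of_isLowerSet h0 h1 (isLowerSet_avoid _) (isLowerSet_avoid _))
  have := one_sub_sum_le_bernoulliProb_avoid h0 h1 (smallSupports d g)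
  linarith

lemma one_sub_pow_le_bernoulliProb_avoid_fullSupports {d : ℕ} {p : ℝ} (h0 : 0 ≤ p) (h1 : p ≤ 1)
    (g : G) : (1 - p ^ d) ^ #(fullSupports d g) ≤ bernoulliProb p (avoid (fullSupports d g)) := by
  refine le_trans (le_of_eq ?_) (prod_le_bernoulliProb_avoid h0 h1 _)
  rw [← prod_const]
  exact prod_congr rfl fun A hA => by rw [(mem_fullSupports.1 hA).1]

/-- Above, small supports are dropped and Janson is applied to the full supports of `h` relative to
those of `g`. Below, Harris recovers each single probability up to `1 - δ`, so the probability of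
avoiding the full supports of `g` need not be computed. -/
lemma bernoulliProb_unreached_inter_le {d : ℕ} {p δ : ℝ} (h0 : 0 ≤ p) (h1 : p ≤ 1)
    (hq : p ^ d ≤ 1 / 2) (hδ : δ < 1) {g h : G}
    (hg : ∑ B ∈ smallSupports d g, p ^ #B ≤ δ) (hh : ∑ B ∈ smallSupports d h, p ^ #B ≤ δ)
    (hgh : #(fullSupports d g ∩ fullSupports d h) * p ^ d ≤ δ)
    (hpair : ∀ k : G, ∑ A ∈ fullSupports d h,
      ∑ B ∈ fullSupports d k with B ≠ A ∧ ¬ Disjoint A B, p ^ #(A ∪ B) ≤ δ) :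
    bernoulliProb p (unreached d g ∩ unreached d h) ≤ Real.exp (6 * δ) / (1 - δ) ^ 2 *
      (bernoulliProb p (unreached d g) * bernoulliProb p (unreached d h)) := by
  have hsub : unreached d g ∩ unreached d h ⊆ avoid (fullSupports d h ∪ fullSupports d g) := by
    simp only [unreached, avoid_union]
    exact fun S hS => ⟨hS.2.1, hS.1.1⟩
  have hJ := bernoulliProb_avoid_union_le h0 h1 hq (fullSupports d h) (fullSupports d g)
    fun A hA => (mem_fullSupports.1 hA).1
  -- One `δ` each for overlaps within `h`, proper overlaps with `g`, and supports common to both.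
  -- Janson's factor 2 turns `3 * δ` into `6 * δ`.
  have hsum : ∑ A ∈ fullSupports d h,
      (∑ B ∈ (fullSupports d h).erase A with ¬ Disjoint A B, p ^ #(A ∪ B) +
        ∑ B ∈ fullSupports d g with ¬ Disjoint A B, p ^ #(A ∪ B)) ≤ 3 * δ := by
    have e1 : ∀ A, ∑ B ∈ (fullSupports d h).erase A with ¬ Disjoint A B, p ^ #(A ∪ B) =
        ∑ B ∈ fullSupports d h with B ≠ A ∧ ¬ Disjoint A B, p ^ #(A ∪ B) := by
      intro A
      congr 1
      ext B
      simp only [mem_filter, mem_erase]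
      tauto
    have e2 : ∀ A ∈ fullSupports d h,
        ∑ B ∈ fullSupports d g with ¬ Disjoint A B, p ^ #(A ∪ B) ≤
        ∑ B ∈ fullSupports d g with B ≠ A ∧ ¬ Disjoint A B, p ^ #(A ∪ B) +
          if A ∈ fullSupports d g then p ^ d else 0 := by
      intro A hA
      have hsplit : {B ∈ fullSupports d g | ¬ Disjoint A B} ⊆
          {B ∈ fullSupports d g | B ≠ A ∧ ¬ Disjoint A B} ∪
            {B ∈ fullSupports d g | B = A} := by
        intro B
        simp only [mem_union, mem_filter]
        tauto
      refine (sum_le_sum_of_subset_of_nonneg hsplit fun B _ _ => pow_nonneg h0 _).trans ?_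
      rw [sum_union (disjoint_filter.2 fun B _ h h' => h.1 h')]
      refine add_le_add le_rfl (le_of_eq ?_)
      rw [filter_eq']
      split_ifs
      · rw [sum_singleton, union_self, (mem_fullSupports.1 hA).1]
      · rw [sum_empty]
    have e3 : ∑ A ∈ fullSupports d h, (if A ∈ fullSupports d g then p ^ d else 0) ≤ δ := by
      rw [← sum_filter, sum_const, nsmul_eq_mul, filter_mem_eq_inter, inter_comm]
      exact hgh
    have e4 := sum_le_sum e2
    rw [sum_add_distrib] at e4
    rw [sum_add_distrib, sum_congr rfl fun A _ => e1 A]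
    linarith [hpair g, hpair h]
  have hg' := mul_one_sub_le_bernoulliProb_unreached h0 h1 hg
  have hh' := (mul_le_mul_of_nonneg_right
    (one_sub_pow_le_bernoulliProb_avoid_fullSupports (d := d) h0 h1 h) (by linarith : 0 ≤ 1 - δ)).trans
      (mul_one_sub_le_bernoulliProb_unreached h0 h1 hh)
  have hδ' : 0 < 1 - δ := by linarith
  rw [← le_div_iff₀ hδ'] at hg' hh'
  have hpos : (0 : ℝ) ≤ (1 - p ^ d) ^ #(fullSupports d h) := pow_nonneg (by linarith) _
  calc bernoulliProb p (unreached d g ∩ unreached d h)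
      ≤ _ := bernoulliProb_mono h0 h1 hsub
    _ ≤ _ := hJ
    _ ≤ bernoulliProb p (unreached d g) / (1 - δ) *
          (bernoulliProb p (unreached d h) / (1 - δ)) * Real.exp (6 * δ) := by
        refine mul_le_mul (mul_le_mul hg' hh' hpos ?_) (Real.exp_le_exp.2 (by linarith))
          (Real.exp_nonneg _) ?_
        · exact (bernoulliProb_nonneg h0 h1 _).trans hg'
        · exact mul_nonneg ((bernoulliProb_nonneg h0 h1 _).trans hg') (hpos.trans hh')
    _ = _ := by field_simp

end Estimates

end RandomCayley

/-! ### The second moment argument for unreached elements. -/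

namespace RandomCayley

open Finset

/-- From `1 - q ≥ exp (-q / (1 - q))` and `(1 - ε / 2) ^ 2 ≥ 1 - ε`: replacing `ε` by `ε / 2` pays
for the denominator. -/
lemma exp_neg_le_one_sub_pow {q ε L : ℝ} {M : ℕ} (hε₀ : 0 < ε) (hε₁ : ε ≤ 1)
    (hq : q ≤ ε / 2) (hL : 0 ≤ L) (hM : M * q ≤ (1 - ε) * L) :
    Real.exp (-((1 - ε / 2) * L)) ≤ (1 - q) ^ M := by
  have hq1 : 0 < 1 - q := by linarith
  have hbase : Real.exp (-(q / (1 - q))) ≤ 1 - q := by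
    rw [Real.exp_neg, inv_le_comm₀ (Real.exp_pos _) hq1]
    refine le_trans (le_of_eq ?_) (Real.add_one_le_exp _)
    field_simp
    ring
  refine le_trans ?_ (pow_le_pow_left₀ (Real.exp_nonneg _) hbase M)
  rw [← Real.exp_nat_mul, Real.exp_le_exp, mul_neg, neg_le_neg_iff, ← mul_div_assoc,
    div_le_iff₀ hq1]
  have h1 : (1 - ε / 2) * L * (1 - ε / 2) ≤ (1 - ε / 2) * L * (1 - q) :=
    mul_le_mul_of_nonneg_left (by linarith) (mul_nonneg (by linarith) hL)
  have h2 : 0 ≤ ε ^ 2 / 4 * L := by positivity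
  linarith

lemma card_div_two_le_card_filter {ι : Type*} [Fintype ι] {δ M : ℝ} {f : ι → ℝ} (hδ : 0 < δ) (hf : ∀ g, 0 ≤ f g)
    (hM : ∑ g, f g ≤ M) (h : 2 * M ≤ δ * Fintype.card ι) :
    (Fintype.card ι : ℝ) / 2 ≤ #{g : ι | f g ≤ δ} := by
  have hcard := card_filter_add_card_filter_not (s := (univ : Finset ι)) (fun g => f g ≤ δ)
  have hcard' : (#{g : ι | f g ≤ δ} : ℝ) + #{g : ι | ¬ f g ≤ δ} = Fintype.card ι := by
    exact_mod_cast hcard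
  have hle : (#{g : ι | ¬ f g ≤ δ} : ℝ) * δ ≤ M := by
    rw [← nsmul_eq_mul]
    refine (card_nsmul_le_sum _ f _ fun g hg => ?_).trans
      ((sum_le_sum_of_subset_of_nonneg (filter_subset _ _) fun g _ _ => hf g).trans hM)
    exact (not_le.1 (mem_filter.1 hg).2).le
  nlinarith

/-- For a bad pair only `P(E g ∩ E h) ≤ P(E g)` is used. With at most `b` bad partners each, these
pairs add at most `b * m ≤ δ * m ^ 2` to the second moment, `m` being the mean. -/
lemma le_bernoulliProb_biUnion_of_pairs {ι : Type*} [DecidableEq ι] {α : Type*} [Fintype α]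
    [DecidableEq α] {p K b δ : ℝ} (h0 : 0 ≤ p) (h1 : p ≤ 1) (C : Finset ι)
    (E : ι → Set (Finset α)) (bad : ι → Finset ι) (hK : 0 < K) (hδ : 0 < δ)
    (hbad : ∀ g ∈ C, (#(bad g) : ℝ) ≤ b)
    (hpair : ∀ g ∈ C, ∀ h ∈ C, h ∉ bad g → bernoulliProb p (E g ∩ E h) ≤
      K * (bernoulliProb p (E g) * bernoulliProb p (E h)))
    (hm : 0 < ∑ g ∈ C, bernoulliProb p (E g)) (hb : b ≤ δ * ∑ g ∈ C, bernoulliProb p (E g)) :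
    1 / (K + δ) ≤ bernoulliProb p (⋃ g ∈ C, E g) := by
  set m := ∑ g ∈ C, bernoulliProb p (E g) with hm_def
  have hnn : ∀ D : Set (Finset α), 0 ≤ bernoulliProb p D := bernoulliProb_nonneg h0 h1
  have hinner : ∀ g ∈ C, ∑ h ∈ C, bernoulliProb p (E g ∩ E h) ≤
      K * bernoulliProb p (E g) * m + b * bernoulliProb p (E g) := by
    intro g hg
    calc ∑ h ∈ C, bernoulliProb p (E g ∩ E h)
        ≤ ∑ h ∈ C, (K * (bernoulliProb p (E g) * bernoulliProb p (E h)) +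
            if h ∈ bad g then bernoulliProb p (E g) else 0) := by
          refine sum_le_sum fun h hh => ?_
          split_ifs with hbg
          · have := bernoulliProb_mono h0 h1 (Set.inter_subset_left (s := E g) (t := E h))
            have : 0 ≤ K * (bernoulliProb p (E g) * bernoulliProb p (E h)) :=
              mul_nonneg hK.le (mul_nonneg (hnn _) (hnn _))
            linarith
          · rw [add_zero]
            exact hpair g hg h hh hbg
      _ = K * bernoulliProb p (E g) * m + #{h ∈ C | h ∈ bad g} * bernoulliProb p (E g) := by
          rw [sum_add_distrib, ← sum_filter, sum_const, nsmul_eq_mul, ← mul_sum, ← mul_sum,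
            mul_assoc]
      _ ≤ _ := by
          refine add_le_add le_rfl (mul_le_mul_of_nonneg_right ?_ (hnn _))
          refine le_trans ?_ (hbad g hg)
          exact_mod_cast card_le_card fun h hh => (mem_filter.1 hh).2
  have htotal : ∑ g ∈ C, ∑ h ∈ C, bernoulliProb p (E g ∩ E h) ≤ (K + δ) * m ^ 2 := by
    refine (sum_le_sum hinner).trans ?_
    rw [sum_add_distrib, ← sum_mul, ← mul_sum, ← mul_sum, ← hm_def]
    have := mul_le_mul_of_nonneg_right hb hm.le
    linarith
  have hsq := (sq_sum_bernoulliProb_le h0 h1 C E).trans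
    (mul_le_mul_of_nonneg_left htotal (hnn _))
  rw [← hm_def] at hsq
  rw [div_le_iff₀ (by linarith)]
  refine le_of_mul_le_mul_right ?_ (pow_pos hm 2)
  linarith

section SecondMoment

variable {G : Type*} [Group G] [Fintype G] [DecidableEq G]

lemma one_div_le_bernoulliProb_iUnion_unreached {d : ℕ} {p Y L ε δ : ℝ} (h0 : 0 ≤ p) (h1 : p ≤ 1)
    (hd : 1 ≤ d) (hε₀ : 0 < ε) (hε₁ : ε ≤ 1) (hδ₀ : 0 < δ) (hδ₁ : δ ≤ 1 / 2)
    (hL : 1 ≤ L) (hN : Real.exp L = Fintype.card G)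
    (hYd : Y ^ d = Fintype.card G * L) (hy : 2 * p * Fintype.card G ≤ Y)
    (hpd : (2 * p * Fintype.card G) ^ d ≤ (1 - ε) * (Fintype.card G * L))
    (hY : 2 * (3 * d : ℝ) ^ d * (d : ℝ) ^ 3 * L ^ 2 / δ ≤ Y) (hq : p ^ d ≤ ε / 2)
    (hbad : 4 * L * (3 * d : ℝ) ^ d / δ ^ 2 ≤ Real.exp (ε * L / 2)) :
    1 / (Real.exp (6 * δ) / (1 - δ) ^ 2 + δ) ≤ bernoulliProb p (⋃ g : G, unreached d g) := by
  have hd' : (1 : ℝ) ≤ d := by exact_mod_cast hd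
  have hNpos : (0 : ℝ) < Fintype.card G := by rw [← hN]; exact Real.exp_pos L
  have hd3 : (1 : ℝ) ≤ (3 * d : ℝ) ^ d := one_le_pow₀ (by linarith)
  have hL2 : L ≤ L ^ 2 := by nlinarith
  have hdd : (d : ℝ) ≤ (d : ℝ) ^ 3 := by
    simpa using pow_le_pow_right₀ hd' (show 1 ≤ 3 by norm_num)
  have hdd2 : (d : ℝ) ^ 2 ≤ (d : ℝ) ^ 3 := pow_le_pow_right₀ hd' (by norm_num)
  rw [div_le_iff₀ hδ₀] at hY
  have hbigA : 2 * (d : ℝ) ^ 3 * L ^ 2 ≤ Y * δ := by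
    refine le_trans ?_ hY
    have : 0 ≤ 2 * (d : ℝ) ^ 3 * L ^ 2 := by positivity
    nlinarith
  have hbigB : 2 * ((3 * d : ℝ) ^ d * d * L) ≤ Y * δ := by
    refine le_trans ?_ hY
    have : (3 * d : ℝ) ^ d * d * L ≤ (3 * d : ℝ) ^ d * (d : ℝ) ^ 3 * L ^ 2 := by gcongr
    linarith
  have hYpos : 0 < Y := by
    have : 0 < Y * δ := lt_of_lt_of_le (by positivity) hbigA
    exact pos_of_mul_pos_left this hδ₀.le
  have hYδ : Y * δ ≤ Y := mul_le_of_le_one_right hYpos.le (by linarith)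
  have hY2 : 2 * (d : ℝ) ^ 2 ≤ Y := by
    refine le_trans ?_ (hbigA.trans hYδ)
    have : 1 ≤ L ^ 2 := by nlinarith
    have : (d : ℝ) ^ 2 * 1 ≤ (d : ℝ) ^ 3 * L ^ 2 := by gcongr
    linarith
  have hY1 : 1 ≤ Y := by nlinarith
  have hpN : 0 ≤ p * Fintype.card G := mul_nonneg h0 hNpos.le
  have hF : ∀ g : G, #(fullSupports d g) * p ^ d ≤ (1 - ε) * L := by
    intro g
    have hc : (#(fullSupports d g) : ℝ) ≤ 2 ^ d * (Fintype.card G : ℝ) ^ (d - 1) := by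
      exact_mod_cast card_fullSupports_le hd g
    refine (mul_le_mul_of_nonneg_right hc (pow_nonneg h0 d)).trans ?_
    refine le_of_mul_le_mul_right ?_ hNpos
    calc _ = (2 * p * Fintype.card G) ^ d := by
          rw [mul_pow, mul_pow, ← Nat.sub_add_cancel hd, pow_succ (Fintype.card G : ℝ)]
          simp only [Nat.sub_add_cancel hd]
          ring
      _ ≤ _ := hpd
      _ = _ := by ring
  have hF' : ∀ g : G, #(fullSupports d g) * p ^ d ≤ L := fun g =>
    (hF g).trans (mul_le_of_le_one_left (by linarith) (by linarith))
  have hpair : ∀ h k : G, ∑ A ∈ fullSupports d h,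
      ∑ B ∈ fullSupports d k with B ≠ A ∧ ¬ Disjoint A B, p ^ #(A ∪ B) ≤ δ := by
    intro h k
    calc _ ≤ ∑ A ∈ fullSupports d h, p ^ d * (2 * (d : ℝ) ^ 3 * L / Y) :=
          sum_le_sum fun A hA => sum_pow_card_union_le hd h0 (by linarith) hYd hy hY2 k
            (mem_fullSupports.1 hA).1
      _ = #(fullSupports d h) * p ^ d * (2 * (d : ℝ) ^ 3 * L / Y) := by
          rw [sum_const, nsmul_eq_mul]
          ring
      _ ≤ L * (2 * (d : ℝ) ^ 3 * L / Y) :=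
          mul_le_mul_of_nonneg_right (hF' h) (by positivity)
      _ = 2 * (d : ℝ) ^ 3 * L ^ 2 / Y := by ring
      _ ≤ δ := by rw [div_le_iff₀ hYpos]; linarith
  set C : Finset G := {g | ∑ B ∈ smallSupports d g, p ^ #B ≤ δ} with hC
  have hCcard : (Fintype.card G : ℝ) / 2 ≤ #C := by
    refine card_div_two_le_card_filter hδ₀ (fun g => sum_nonneg fun B _ => pow_nonneg h0 _)
      (sum_smallSupports_le hd h0 hYd (by linarith) hY1) ?_
    have : (3 * d : ℝ) ^ d * (d * (Fintype.card G * L / Y)) =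
        (3 * d : ℝ) ^ d * d * L * Fintype.card G / Y := by ring
    rw [this, ← mul_div_assoc, div_le_iff₀ hYpos]
    nlinarith
  have hlow : ∀ g ∈ C, Real.exp (-((1 - ε / 2) * L)) / 2 ≤ bernoulliProb p (unreached d g) := by
    intro g hg
    refine le_trans ?_ (mul_one_sub_le_bernoulliProb_unreached h0 h1 (mem_filter.1 hg).2)
    have hexp := (exp_neg_le_one_sub_pow hε₀ hε₁ hq (by linarith) (hF g)).trans
      (one_sub_pow_le_bernoulliProb_avoid_fullSupports h0 h1 g)
    have := Real.exp_nonneg (-((1 - ε / 2) * L))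
    nlinarith
  -- At least `N / 2` good elements, each unreached with probability at least `N ^ (-(1 - ε / 2)) /
  -- 2`.
  have hm : Real.exp (ε * L / 2) / 4 ≤ ∑ g ∈ C, bernoulliProb p (unreached d g) := by
    calc Real.exp (ε * L / 2) / 4
        = Fintype.card G / 2 * (Real.exp (-((1 - ε / 2) * L)) / 2) := by
          have : ε * L / 2 = L + -((1 - ε / 2) * L) := by ring
          rw [this, Real.exp_add, hN]
          ring
      _ ≤ #C * (Real.exp (-((1 - ε / 2) * L)) / 2) :=
          mul_le_mul_of_nonneg_right hCcard (by positivity)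
      _ ≤ _ := by
          rw [← nsmul_eq_mul]
          exact card_nsmul_le_sum _ _ _ hlow
  refine (le_bernoulliProb_biUnion_of_pairs h0 h1 C (unreached d)
    (fun g => {h | δ < #(fullSupports d g ∩ fullSupports d h) * p ^ d})
    (b := L * (3 * d : ℝ) ^ d / δ) ?_ hδ₀ ?_ ?_ ?_ ?_).trans (bernoulliProb_mono h0 h1 ?_)
  · have : 0 < 1 - δ := by linarith
    positivity
  · exact fun g _ => card_filter_lt_card_inter_le hd h0 hδ₀ g (hF' g)
  · intro g hg h hh hgh
    refine bernoulliProb_unreached_inter_le h0 h1 (by linarith) (by linarith)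
      (mem_filter.1 hg).2 (mem_filter.1 hh).2 ?_ (hpair h)
    simpa using hgh
  · exact lt_of_lt_of_le (by positivity) hm
  · rw [div_le_iff₀ hδ₀]
    rw [div_le_iff₀ (by positivity)] at hbad
    nlinarith [mul_le_mul_of_nonneg_right hm (sq_nonneg δ)]
  · exact Set.iUnion_mono fun g => Set.iUnion_subset fun _ => subset_rfl

end SecondMoment

end RandomCayley

/-! ### Asymptotics in `L = log N` and transfer to the random graph. -/

namespace RandomCayley

open Filter Topology

lemma eventually_log_conditions {ε δ : ℝ} (hε : 0 < ε) :
    ∀ᶠ L : ℝ in atTop, 5 ≤ Real.log L ∧ 4 * Real.log L + Real.log (2 / δ) ≤ √L / 2 ∧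
      Real.log (4 / δ ^ 2) + Real.log L + √L * Real.log L ≤ ε * L / 2 ∧
      L ≤ ε / 2 * Real.exp L := by
  have hsqrt : Tendsto (fun L : ℝ => √L) atTop atTop := Real.tendsto_sqrt_atTop
  have hlog : Real.log =o[atTop] fun L : ℝ => √L := by
    simpa [Real.sqrt_eq_rpow] using isLittleO_log_rpow_atTop (r := 1 / 2) (by norm_num)
  have hconst : ∀ c : ℝ, (fun _ : ℝ => c) =o[atTop] fun L : ℝ => √L := fun c =>
    Asymptotics.isLittleO_const_left.2 (Or.inr (tendsto_norm_atTop_atTop.comp hsqrt))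
  have hexp : (fun L : ℝ => L) =o[atTop] Real.exp := by
    simpa using Real.isLittleO_pow_exp_atTop (n := 1)
  filter_upwards [Real.tendsto_log_atTop.eventually_ge_atTop 5, eventually_ge_atTop 1,
    hlog.bound (c := 1 / 16) (by norm_num), hlog.bound (c := ε / 6) (by positivity),
    (hconst (Real.log (2 / δ))).bound (c := 1 / 4) (by norm_num),
    (hconst (Real.log (4 / δ ^ 2))).bound (c := ε / 6) (by positivity),
    hexp.bound (c := ε / 2) (by positivity)] with L h5 h1 ha hb hc hd he
  have hs : 0 ≤ √L := Real.sqrt_nonneg L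
  rw [Real.norm_of_nonneg hs] at ha hb hc hd
  rw [Real.norm_of_nonneg (Real.exp_nonneg L)] at he
  have ha' := (le_abs_self _).trans ha
  have hb' := (le_abs_self _).trans hb
  have hc' := (le_abs_self _).trans hc
  have hd' := (le_abs_self _).trans hd
  have hss : √L * √L = L := Real.mul_self_sqrt (by linarith)
  have hs1 : 1 ≤ √L := Real.one_le_sqrt.2 h1
  have hsL : √L ≤ L := by nlinarith
  refine ⟨h5, by linarith, ?_, (le_abs_self _).trans he⟩
  have h6 : ε / 6 * √L ≤ ε / 6 * L := mul_le_mul_of_nonneg_left hsL (by positivity)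
  have h7 : √L * Real.log L ≤ ε / 6 * L := by
    calc √L * Real.log L ≤ √L * (ε / 6 * √L) := mul_le_mul_of_nonneg_left hb' hs
      _ = ε / 6 * (√L * √L) := by ring
      _ = ε / 6 * L := by rw [hss]
  linarith

lemma sq_mul_log_le_of_le_diamBound {γ : ℝ} {d N : ℕ} (hγ₀ : 0 < γ)
    (hlog : 0 < Real.log (Real.log N)) (hd : (d : ℝ) ≤ diamBound γ N) :
    2 * (d : ℝ) ^ 2 * Real.log (Real.log N) ≤ Real.log N := by
  have h1 : (d : ℝ) ≤ √(Real.log N / (2 * Real.log (Real.log N))) :=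
    hd.trans (mul_le_of_le_one_left (Real.sqrt_nonneg _) (by linarith))
  have h2 := (Real.le_sqrt (Nat.cast_nonneg d) (by positivity)).1 h1
  rw [le_div_iff₀ (by positivity)] at h2
  linarith

lemma three_mul_pow_le_exp {d : ℕ} {L : ℝ} (hL : 0 < L) (hlog : 5 ≤ Real.log L)
    (hd : 2 * (d : ℝ) ^ 2 * Real.log L ≤ L) :
    (3 * d : ℝ) ^ d ≤ Real.exp (d * Real.log L / 2) := by
  -- With `log L ≥ 5` the bound on `d` gives `10 d² ≤ L`.
  have h9 : (3 * d : ℝ) ^ 2 ≤ L := by nlinarith [sq_nonneg (d : ℝ)]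
  have h3 : (3 * d : ℝ) ≤ Real.exp (Real.log L / 2) := by
    refine le_of_pow_le_pow_left₀ two_ne_zero (Real.exp_nonneg _) ?_
    rw [← Real.exp_nat_mul]
    push_cast
    rw [mul_div_cancel₀ _ (two_ne_zero), Real.exp_log hL]
    exact h9
  refine (pow_le_pow_left₀ (by positivity) h3 d).trans (le_of_eq ?_)
  rw [← Real.exp_nat_mul, mul_div_assoc]

lemma pow_mul_pow_le_exp_div {d : ℕ} {L δ : ℝ} (hL : 0 < L) (hδ : 0 < δ) (hd1 : 1 ≤ d)
    (hlog : 5 ≤ Real.log L) (hd : 2 * (d : ℝ) ^ 2 * Real.log L ≤ L)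
    (h : 4 * Real.log L + Real.log (2 / δ) ≤ √L / 2) :
    2 * (3 * d : ℝ) ^ d * (d : ℝ) ^ 3 * L ^ 2 / δ ≤ Real.exp (L / d) := by
  have hd1' : (1 : ℝ) ≤ d := by exact_mod_cast hd1
  have hdL : (d : ℝ) ^ 2 ≤ L := by nlinarith [sq_nonneg (d : ℝ)]
  have hd3 : (d : ℝ) ^ 3 ≤ L ^ 2 := by
    calc (d : ℝ) ^ 3 ≤ (d : ℝ) ^ 4 := pow_le_pow_right₀ hd1' (by norm_num)
      _ = ((d : ℝ) ^ 2) ^ 2 := by ring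
      _ ≤ L ^ 2 := pow_le_pow_left₀ (by positivity) hdL 2
  have hds : (d : ℝ) ≤ √L := Real.le_sqrt_of_sq_le hdL
  -- The average of `√L ≤ L / d` and `2 d log L ≤ L / d`: the first absorbs constants and powers of
  -- `L`, the second absorbs `(3d) ^ d`.
  have hLd : √L / 2 + d * Real.log L ≤ L / d := by
    rw [le_div_iff₀ (by linarith)]
    have : √L * d ≤ L := by
      calc √L * d ≤ √L * √L := mul_le_mul_of_nonneg_left hds (Real.sqrt_nonneg L)
        _ = L := Real.mul_self_sqrt hL.le
    nlinarith
  calc 2 * (3 * d : ℝ) ^ d * (d : ℝ) ^ 3 * L ^ 2 / δ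
      = 2 / δ * ((3 * d : ℝ) ^ d * ((d : ℝ) ^ 3 * L ^ 2)) := by ring
    _ ≤ 2 / δ * (Real.exp (d * Real.log L / 2) * (L ^ 2 * L ^ 2)) := by
        gcongr
        exact three_mul_pow_le_exp hL hlog hd
    _ = Real.exp (Real.log (2 / δ) + (d * Real.log L / 2 + 4 * Real.log L)) := by
        have h4 : Real.exp (4 * Real.log L) = L ^ 2 * L ^ 2 := by
          rw [← pow_add]
          have := Real.exp_nat_mul (Real.log L) 4
          rw [Real.exp_log hL] at this
          exact_mod_cast this
        rw [Real.exp_add, Real.exp_add, Real.exp_log (by positivity), h4]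
    _ ≤ Real.exp (L / d) := by
        refine Real.exp_le_exp.2 ?_
        have : 0 ≤ d * Real.log L := by positivity
        linarith

lemma mul_pow_le_exp_mul {d : ℕ} {L δ ε : ℝ} (hL : 0 < L) (hδ : 0 < δ)
    (hlog : 5 ≤ Real.log L) (hd : 2 * (d : ℝ) ^ 2 * Real.log L ≤ L)
    (h : Real.log (4 / δ ^ 2) + Real.log L + √L * Real.log L ≤ ε * L / 2) :
    4 * L * (3 * d : ℝ) ^ d / δ ^ 2 ≤ Real.exp (ε * L / 2) := by
  have hdL : (d : ℝ) ^ 2 ≤ L := by nlinarith [sq_nonneg (d : ℝ)]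
  have hds : (d : ℝ) ≤ √L := Real.le_sqrt_of_sq_le hdL
  calc 4 * L * (3 * d : ℝ) ^ d / δ ^ 2 = 4 / δ ^ 2 * (L * (3 * d : ℝ) ^ d) := by ring
    _ ≤ 4 / δ ^ 2 * (L * Real.exp (d * Real.log L / 2)) := by
        gcongr
        exact three_mul_pow_le_exp hL hlog hd
    _ = Real.exp (Real.log (4 / δ ^ 2) + (Real.log L + d * Real.log L / 2)) := by
        rw [Real.exp_add, Real.exp_add, Real.exp_log (by positivity), Real.exp_log hL]
    _ ≤ _ := by
        refine Real.exp_le_exp.2 ?_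
        have h1 : d * Real.log L ≤ √L * Real.log L :=
          mul_le_mul_of_nonneg_right hds (by linarith)
        have h2 : 0 ≤ d * Real.log L := mul_nonneg (Nat.cast_nonneg d) (by linarith)
        linarith

lemma exists_one_sub_le_one_div {η : ℝ} (hη : 0 < η) : ∃ δ : ℝ, 0 < δ ∧ δ ≤ 1 / 2 ∧
    1 - η ≤ 1 / (Real.exp (6 * δ) / (1 - δ) ^ 2 + δ) := by
  have hcont : ContinuousAt (fun δ : ℝ => 1 / (Real.exp (6 * δ) / (1 - δ) ^ 2 + δ)) 0 := by
    refine continuousAt_const.div (ContinuousAt.add (ContinuousAt.div (by fun_prop) (by fun_prop)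
      (by norm_num)) continuousAt_id) (by norm_num)
  have h0 : 1 - η < 1 / (Real.exp (6 * (0 : ℝ)) / (1 - 0) ^ 2 + 0) := by
    norm_num
    exact hη
  have h1 := (hcont.eventually_const_lt h0).filter_mono (nhdsWithin_le_nhds (s := Set.Ioi 0))
  have h2 : ∀ᶠ δ : ℝ in 𝓝[>] 0, δ ∈ Set.Ioc (0 : ℝ) (1 / 2) :=
    Ioc_mem_nhdsGT (by norm_num)
  obtain ⟨δ, hlt, hmem⟩ := (h1.and h2).exists
  exact ⟨δ, hmem.1, hmem.2, hlt.le⟩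

/-- An inequality suffices, and `le_map_apply` needs no measurability of the diameter event. -/
lemma bernoulliProb_le_randomCayleyGraph_real {G : Type*} [Group G] [Fintype G] [DecidableEq G]
    (p : unitInterval) (d : ℕ) :
    bernoulliProb p (⋃ g : G, unreached d g) ≤
      (randomCayleyGraph G p).real {Γ : SimpleGraph G | (d : ℕ∞) < Γ.ediam} := by
  calc bernoulliProb p (⋃ g : G, unreached d g)
      ≤ bernoulliProb p {S : Finset G | (S : Set G) ∈
          {T : Set G | (d : ℕ∞) < (SimpleGraph.mulCayley T).ediam}} := by
        refine bernoulliProb_mono p.2.1 p.2.2 fun S hS => ?_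
        obtain ⟨g, hg⟩ := Set.mem_iUnion.1 hS
        exact lt_ediam_of_mem_unreached hg
    _ ≤ _ := by
        rw [bernoulliProb_eq_setBernoulli, MeasureTheory.measureReal_def,
          MeasureTheory.measureReal_def]
        refine ENNReal.toReal_mono (MeasureTheory.measure_ne_top _ _) ?_
        exact MeasureTheory.Measure.le_map_apply (measurable_mulCayley G).aemeasurable _

end RandomCayley

open Filter in
theorem theorem2 (γ ε : ℝ) (hγ₀ : 0 < γ) (hγ₁ : γ < 1) (hε₀ : 0 < ε) (hε₁ : ε ≤ 1) :
    ∀ η : ℝ, 0 < η → ∃ N₀ : ℕ, ∀ N : ℕ, N₀ ≤ N →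
      ∀ (G : Type*) [Group G] [Finite G], Nat.card G = N →
      ∀ d : ℕ, 2 ≤ d → (d : ℝ) ≤ RandomCayley.diamBound γ N →
      ∀ p : unitInterval,
        (p : ℝ) ≤ ((1 - ε) / 2 ^ d * (Real.log N / (N : ℝ) ^ (d - 1))) ^ (1 / (d : ℝ)) →
        1 - η ≤ (RandomCayley.randomCayleyGraph G p).real
          {Γ : SimpleGraph G | (d : ℕ∞) < Γ.ediam} := by
  classical
  intro η hη
  obtain ⟨δ, hδ₀, hδ₁, hδη⟩ := RandomCayley.exists_one_sub_le_one_div hη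
  have hev := (Real.tendsto_log_atTop.comp tendsto_natCast_atTop_atTop).eventually
    ((RandomCayley.eventually_log_conditions (δ := δ) hε₀).and (eventually_ge_atTop 1))
  obtain ⟨N₀, hN₀⟩ := eventually_atTop.1 (hev.and (eventually_ge_atTop 1))
  refine ⟨N₀, fun N hN G _ _ hG d hd hdb p hp => ?_⟩
  obtain ⟨⟨⟨h5, hA, hB, hexp⟩, hL1⟩, hN1⟩ := hN₀ N hN
  simp only [Function.comp_apply] at h5 hA hB hexp hL1
  set L := Real.log N with hL
  have hLpos : 0 < L := by linarith
  have hNpos : (0 : ℝ) < N := by exact_mod_cast hN1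
  have hexpL : Real.exp L = N := Real.exp_log hNpos
  have := Fintype.ofFinite G
  have hcard : (Fintype.card G : ℝ) = N := by rw [← hG, Nat.card_eq_fintype_card]
  have hdsq := RandomCayley.sq_mul_log_le_of_le_diamBound hγ₀ (by linarith) hdb
  have hd0 : d ≠ 0 := by omega
  have hp0 : (0 : ℝ) ≤ p := p.2.1
  have hX0 : 0 ≤ (1 - ε) / 2 ^ d * (L / (N : ℝ) ^ (d - 1)) :=
    mul_nonneg (div_nonneg (by linarith) (by positivity)) (by positivity)
  have hpd : (p : ℝ) ^ d ≤ (1 - ε) / 2 ^ d * (L / (N : ℝ) ^ (d - 1)) := by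
    refine (pow_le_pow_left₀ hp0 hp d).trans (le_of_eq ?_)
    rw [one_div, Real.rpow_inv_natCast_pow hX0 hd0]
  have hypd : (2 * (p : ℝ) * N) ^ d ≤ (1 - ε) * (N * L) := by
    calc (2 * (p : ℝ) * N) ^ d = 2 ^ d * N ^ d * (p : ℝ) ^ d := by ring
      _ ≤ 2 ^ d * N ^ d * ((1 - ε) / 2 ^ d * (L / (N : ℝ) ^ (d - 1))) := by gcongr
      _ = (1 - ε) * (N * L) := by
        obtain ⟨k, rfl⟩ : ∃ k, d = k + 1 := ⟨d - 1, by omega⟩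
        rw [Nat.add_sub_cancel, pow_succ (N : ℝ)]
        field_simp
  have hq : (p : ℝ) ^ d ≤ ε / 2 := by
    have h1 : (1 - ε) / 2 ^ d ≤ 1 := by
      rw [div_le_one (by positivity)]
      have : (1 : ℝ) ≤ 2 ^ d := one_le_pow₀ (by norm_num)
      linarith
    -- Here `2 ≤ d` enters: it makes `p ^ d` tend to zero.
    have h2 : L / (N : ℝ) ^ (d - 1) ≤ L / N := by
      refine div_le_div_of_nonneg_left hLpos.le hNpos ?_
      have := pow_le_pow_right₀ (show (1 : ℝ) ≤ N by exact_mod_cast hN1)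
        (show 1 ≤ d - 1 by omega)
      rwa [pow_one] at this
    have h3 : L / N ≤ ε / 2 := by
      rw [div_le_iff₀ hNpos, ← hexpL]
      exact hexp
    have h4 : 0 ≤ L / (N : ℝ) ^ (d - 1) := by positivity
    exact hpd.trans ((mul_le_of_le_one_left h4 h1).trans (h2.trans h3))
  set Y : ℝ := (N * L) ^ (1 / (d : ℝ)) with hY
  have hY0 : 0 ≤ Y := by positivity
  have hYd : Y ^ d = N * L := by
    rw [hY, one_div, Real.rpow_inv_natCast_pow (by positivity) hd0]
  have hyY : 2 * (p : ℝ) * N ≤ Y := by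
    refine le_of_pow_le_pow_left₀ hd0 hY0 ?_
    rw [hYd]
    exact hypd.trans (mul_le_of_le_one_left (by positivity) (by linarith))
  -- That is, `N ^ (1 / d) ≤ Y`, since `L ≥ 1`.
  have hYN : Real.exp (L / d) ≤ Y := by
    refine le_of_pow_le_pow_left₀ hd0 hY0 ?_
    rw [hYd, ← Real.exp_nat_mul, mul_div_cancel₀ _ (by positivity), hexpL]
    exact le_mul_of_one_le_right hNpos.le hL1
  refine hδη.trans ((RandomCayley.one_div_le_bernoulliProb_iUnion_unreached (G := G) (L := L)
    (Y := Y) (d := d) hp0 p.2.2 (by omega) hε₀ hε₁ hδ₀ hδ₁ hL1 ?_ ?_ ?_ ?_ ?_ hq ?_).trans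
    (RandomCayley.bernoulliProb_le_randomCayleyGraph_real p d))
  · rw [hcard, hexpL]
  · rw [hcard, hYd]
  · rwa [hcard]
  · rwa [hcard]
  · exact (RandomCayley.pow_mul_pow_le_exp_div hLpos hδ₀ (by omega) h5 hdsq hA).trans hYN
  · exact RandomCayley.mul_pow_le_exp_mul hLpos hδ₀ h5 hdsq hB
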